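/- All graphs are finite, without loops and multiple edges. For a graph $X$, let $L(X)$ be its line graph, and let $X''=X\times K_2$ be its Kronecker double cover: the vertex set is $V(X)\times V(K_2)$, and $(u,i)$, $(v,j)$ are adjacent if and only if $u,v$ are adjacent in $X$ and $i\neq j$. Let each edge of $X$ be taken with both of its orientations, and for an oriented edge $e$ let $s(e)$ and $t(e)$ be its starting and terminal vertex. The edge adjacency matrix $M$ of $X$ is indexed by the oriented edges of $X$, with $M_{ef}=1$ if $t(e)=s(f)$ and $s(e)\neq t(f)$, and $M_{ef}=0$ otherwise. The symmetric edge graph $\gamma(X)$ is the graph on the oriented edges of $X$ whose adjacency matrix is $M+M^T$. Theorem. Let $X$ be a connected graph. Then: 1. $\gamma(X)$ is isomorphic to $L(X)''$ if and only if $X$ is bipartite. 2. $\gamma(X)$ is isomorphic to $L(X'')$ if and only if one of the following holds: $X$ is a path graph $P_n$ on $n\geq 1$ vertices; $X$ is a cycle graph $C_n$ with $n\ge 3$ even; $X$ is isomorphic to $K_4$, to $K_4-e$ (the graph $K_4$ with one edge removed), or to a triangle with a pendant vertex (a triangle together with one further vertex that is adjacent to exactly one vertex of the triangle). 3. $L(X'')$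 is isomorphic to $L(X)''$ if and only if $X$ is a cycle graph $C_n$ with $n\ge 3$ or a path graph $P_n$ with $n\geq 1$. -/

import Mathlib

namespace SimpleGraph

/-- The Kronecker product of two graphs: `(u, u')` and `(v, v')` are adjacent iff
`u` is adjacent to `v` and `u'` is adjacent to `v'`. -/
def kroneckerProd {V W : Type*} (X : SimpleGraph V) (Y : SimpleGraph W) :
    SimpleGraph (V × W) where
  Adj p q := X.Adj p.1 q.1 ∧ Y.Adj p.2 q.2
  symm := ⟨fun _ _ h => ⟨h.1.symm, h.2.symm⟩⟩
  loopless := ⟨fun _ h => h.1.ne rfl⟩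

/-- The Kronecker double cover of `X`: its Kronecker product with `K₂`. -/
def kroneckerDouble {V : Type*} (X : SimpleGraph V) : SimpleGraph (V × Fin 2) :=
  X.kroneckerProd (completeGraph (Fin 2))

open Classical in
/-- The edge adjacency matrix of `X`, indexed by the oriented edges of `X` (every edge occurs with
both orientations): the entry at `(e, f)` is `1` if `f` starts where `e` ends and `f` does not
end where `e` starts, and `0` otherwise. -/
noncomputable def edgeAdjMatrix {V : Type*} (X : SimpleGraph V) : Matrix X.Dart X.Dart ℕ :=
  Matrix.of fun e f => if e.snd = f.fst ∧ e.fst ≠ f.snd then 1 else 0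

/-- The symmetric edge graph of `X`, on the oriented edges of `X`. -/
def symmEdgeGraph {V : Type*} (X : SimpleGraph V) : SimpleGraph X.Dart where
  Adj e f := (e.snd = f.fst ∧ e.fst ≠ f.snd) ∨ (f.snd = e.fst ∧ f.fst ≠ e.snd)
  symm := ⟨fun _ _ h => h.symm⟩
  loopless := ⟨fun e h => h.elim (fun h => e.snd_ne_fst h.1) (fun h => e.snd_ne_fst h.1)⟩

open Classical in
/-- The symmetric edge graph of `X` is the graph with adjacency matrix `M + Mᵀ`, where `M` is
the edge adjacency matrix of `X`. -/
theorem adjMatrix_symmEdgeGraph {V : Type*} (X : SimpleGraph V) :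
    X.symmEdgeGraph.adjMatrix ℕ = X.edgeAdjMatrix + X.edgeAdjMatrix.transpose := by
  ext e f
  have h : X.symmEdgeGraph.Adj e f ↔
      (e.snd = f.fst ∧ e.fst ≠ f.snd) ∨ (f.snd = e.fst ∧ f.fst ≠ e.snd) := Iff.rfl
  simp only [adjMatrix_apply, h, edgeAdjMatrix, Matrix.add_apply, Matrix.of_apply,
    Matrix.transpose_apply]
  grind

/-- `X` is a path graph `Pₙ` (on `n` vertices). -/
def IsPathGraph {V : Type*} (X : SimpleGraph V) : Prop :=
  ∃ n : ℕ, 1 ≤ n ∧ Nonempty (X ≃g pathGraph n)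

/-- `X` is a cycle graph `Cₙ` (on `n ≥ 3` vertices). -/
def IsCycleGraph {V : Type*} (X : SimpleGraph V) : Prop :=
  ∃ n : ℕ, 3 ≤ n ∧ Nonempty (X ≃g cycleGraph n)

/-- `X` is a cycle graph on an even number of vertices. -/
def IsEvenCycleGraph {V : Type*} (X : SimpleGraph V) : Prop :=
  ∃ n : ℕ, 3 ≤ n ∧ Even n ∧ Nonempty (X ≃g cycleGraph n)

/-- `K₄ - e`: the complete graph on four vertices with one edge removed. -/
def completeFourMinusEdge : SimpleGraph (Fin 4) :=
  (completeGraph (Fin 4)).deleteEdges {s(0, 1)}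

/-- The triangle on `0, 1, 2` with a pendant vertex `3` attached at `2`. -/
def triangleWithPendant : SimpleGraph (Fin 4) :=
  fromEdgeSet {s(0, 1), s(1, 2), s(0, 2), s(2, 3)}

end SimpleGraph

/-! Let `X'' = X × K₂`. An oriented edge `(u, v)` corresponds to the edge `{(u, 0), (v, 1)}` of
`X''`, so `L(X'')` is the graph on the oriented edges in which two of them are adjacent if they
share their start or their end. Likewise `L(X)''` becomes a graph on the oriented edges as soon as
one orientation of each edge is selected.

A Kronecker double is bipartite. A two-coloring of `γ(X)` alternates along cycles of `X`, so it
exists only if `X` is bipartite; conversely, a two-coloring of `X` colors each oriented edge by its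
start and identifies `γ(X)` with `L(X)''`. In `L(X'')` the oriented edges that leave a vertex form a
clique, so a two-coloring bounds the degrees of `X` by two, and `X` is a path or a cycle;
conversely, a direction of travel along a path or a cycle identifies `L(X'')` with `L(X)''`.

Suppose that `γ(X)` is isomorphic to `L(X'')` and that some vertex `v` has degree at least three.
Line graphs contain no claw, and a vertex at distance two from `v` would produce one in `γ(X)`, so
`v` is adjacent to all other vertices. The triangles of `γ(X)` are the directed triangles of `X`,
and `γ(X)` has no clique on four vertices: hence `v` has degree exactly three, and `X` contains a
triangle. Only three graphs are left. For each of them, an isomorphism sends `(i, j)` to the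
complementary edge of `K₄`, suitably oriented and followed by a permutation of the vertices. -/

namespace LineGraphCover

open SimpleGraph

variable {V W : Type*} {X : SimpleGraph V} {Y : SimpleGraph W}

theorem dart_eq_iff {e f : X.Dart} : e = f ↔ e.fst = f.fst ∧ e.snd = f.snd := by
  rw [Dart.ext_iff, Prod.ext_iff]

theorem symmEdgeGraph_adj {e f : X.Dart} : X.symmEdgeGraph.Adj e f ↔
    (e.snd = f.fst ∧ e.fst ≠ f.snd) ∨ (f.snd = e.fst ∧ f.fst ≠ e.snd) :=
  Iff.rfl

theorem kroneckerDouble_adj {p q : V × Fin 2} :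
    X.kroneckerDouble.Adj p q ↔ X.Adj p.1 q.1 ∧ p.2 ≠ q.2 :=
  Iff.rfl

theorem kroneckerDouble_isBipartite (X : SimpleGraph V) : X.kroneckerDouble.IsBipartite :=
  ⟨Coloring.mk Prod.snd fun h => h.2⟩

/-- The graph on the oriented edges of `X` in which distinct oriented edges are adjacent if they
have the same start or the same end. It is a model of the line graph of the Kronecker double cover
that has the same vertices as the symmetric edge graph; see `coincidenceGraphIso`. -/
def coincidenceGraph (X : SimpleGraph V) : SimpleGraph X.Dart where
  Adj e f := e ≠ f ∧ (e.fst = f.fst ∨ e.snd = f.snd)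
  symm := ⟨fun _ _ h => ⟨h.1.symm, h.2.imp Eq.symm Eq.symm⟩⟩
  loopless := ⟨fun _ h => h.1 rfl⟩

theorem coincidenceGraph_adj {e f : X.Dart} :
    (coincidenceGraph X).Adj e f ↔ e ≠ f ∧ (e.fst = f.fst ∨ e.snd = f.snd) :=
  Iff.rfl

/-- The edge of the Kronecker double cover that runs from the start of a dart in layer `0` to its
end in layer `1`. -/
def liftEdge (e : X.Dart) : X.kroneckerDouble.edgeSet :=
  ⟨s((e.fst, 0), (e.snd, 1)), e.adj, Fin.zero_ne_one⟩

theorem liftEdge_injective : Function.Injective (liftEdge (X := X)) := by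
  intro e f h
  rw [dart_eq_iff]
  simpa [liftEdge, Sym2.eq_iff] using congrArg Subtype.val h

theorem liftEdge_surjective : Function.Surjective (liftEdge (X := X)) := by
  rintro ⟨z, hz⟩
  induction z with | _ p q
  obtain ⟨⟨u, i⟩, ⟨v, j⟩⟩ := p, q
  obtain ⟨h, hij⟩ : X.Adj u v ∧ i ≠ j := hz
  obtain ⟨rfl, rfl⟩ | ⟨rfl, rfl⟩ : i = 0 ∧ j = 1 ∨ i = 1 ∧ j = 0 := by omega
  · exact ⟨⟨(u, v), h⟩, rfl⟩
  · exact ⟨⟨(v, u), h.symm⟩, Subtype.ext Sym2.eq_swap⟩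

theorem liftEdge_bijective : Function.Bijective (liftEdge (X := X)) :=
  ⟨liftEdge_injective, liftEdge_surjective⟩

/-- The coincidence graph is the line graph of the Kronecker double cover. -/
noncomputable def coincidenceGraphIso (X : SimpleGraph V) :
    coincidenceGraph X ≃g X.kroneckerDouble.lineGraph where
  toEquiv := Equiv.ofBijective liftEdge liftEdge_bijective
  map_rel_iff' {e f} := by
    simp only [Equiv.ofBijective_apply, lineGraph_adj_iff_exists, coincidenceGraph_adj,
      liftEdge_injective.ne_iff]
    simp [liftEdge]

theorem exists_mem_edge_iff {e f : X.Dart} : (∃ v, v ∈ e.edge ∧ v ∈ f.edge) ↔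
    e.fst = f.fst ∨ e.fst = f.snd ∨ e.snd = f.fst ∨ e.snd = f.snd := by
  simp [Dart.edge, or_assoc]

section LineGraphDoubleCover

variable {s : X.Dart → Fin 2}

theorem edge_color_injective (hs : ∀ e, s e.symm ≠ s e) :
    Function.Injective fun e : X.Dart => ((⟨e.edge, e.edge_mem⟩, s e) : X.edgeSet × Fin 2) := by
  intro e f h
  simp only [Prod.mk.injEq, Subtype.mk.injEq, dart_edge_eq_iff] at h
  obtain ⟨rfl | rfl, h⟩ := h
  · rfl
  · exact absurd h (hs f)

theorem edge_color_surjective (hs : ∀ e, s e.symm ≠ s e) :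
    Function.Surjective fun e : X.Dart => ((⟨e.edge, e.edge_mem⟩, s e) : X.edgeSet × Fin 2) := by
  rintro ⟨⟨z, hz⟩, i⟩
  induction z with | _ u v
  let e : X.Dart := ⟨(u, v), hz⟩
  obtain he | he : s e = i ∨ s e.symm = i := by have := hs e; omega
  · exact ⟨e, Prod.ext rfl he⟩
  · exact ⟨e.symm, Prod.ext (Subtype.ext e.edge_symm) he⟩

theorem edge_color_bijective (hs : ∀ e, s e.symm ≠ s e) :
    Function.Bijective fun e : X.Dart => ((⟨e.edge, e.edge_mem⟩, s e) : X.edgeSet × Fin 2) :=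
  ⟨edge_color_injective hs, edge_color_surjective hs⟩

theorem nonempty_iso_kroneckerDouble_lineGraph {G : SimpleGraph X.Dart}
    (hs : ∀ e, s e.symm ≠ s e)
    (hG : ∀ e f, G.Adj e f ↔ (e.edge ≠ f.edge ∧ ∃ v, v ∈ e.edge ∧ v ∈ f.edge) ∧ s e ≠ s f) :
    Nonempty (G ≃g X.lineGraph.kroneckerDouble) := by
  refine ⟨Equiv.ofBijective _ (edge_color_bijective hs), ?_⟩
  intro e f
  simp only [Equiv.ofBijective_apply, kroneckerDouble_adj, lineGraph_adj_iff_exists, hG, ne_eq,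
    Subtype.mk.injEq]

end LineGraphDoubleCover

theorem nonempty_symmEdgeGraph_iso_of_isBipartite (h : X.IsBipartite) :
    Nonempty (X.symmEdgeGraph ≃g X.lineGraph.kroneckerDouble) := by
  obtain ⟨c⟩ := h
  refine nonempty_iso_kroneckerDouble_lineGraph (s := fun e => c e.fst)
    (fun e => c.valid e.symm.adj) fun e f => ?_
  have he : c e.fst ≠ c e.snd := c.valid e.adj
  have hf : c f.fst ≠ c f.snd := c.valid f.adj
  rw [symmEdgeGraph_adj, ne_eq e.edge, dart_edge_eq_iff, exists_mem_edge_iff]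
  simp only [dart_eq_iff, Dart.symm, Prod.fst_swap, Prod.snd_swap]
  grind

/-- `R` orients every edge of `X` in one direction, so that every vertex has at most one out-edge
and at most one in-edge. -/
structure IsCoherentOrientation (X : SimpleGraph V) (R : V → V → Prop) : Prop where
  adj_iff : ∀ u v, X.Adj u v ↔ R u v ∨ R v u
  asymm : ∀ u v, R u v → ¬ R v u
  out_unique : ∀ u v w, R u v → R u w → v = w
  in_unique : ∀ u v w, R u w → R v w → u = v

theorem IsCoherentOrientation.comap_iso {R : W → W → Prop} (hR : IsCoherentOrientation Y R)
    (φ : X ≃g Y) : IsCoherentOrientation X fun u v => R (φ u) (φ v) where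
  adj_iff u v := by rw [← φ.map_adj_iff, hR.adj_iff]
  asymm u v := hR.asymm _ _
  out_unique _ _ _ h h' := φ.injective (hR.out_unique _ _ _ h h')
  in_unique _ _ _ h h' := φ.injective (hR.in_unique _ _ _ h h')

open Classical in
theorem IsCoherentOrientation.nonempty_coincidenceGraph_iso {R : V → V → Prop}
    (hR : IsCoherentOrientation X R) :
    Nonempty (coincidenceGraph X ≃g X.lineGraph.kroneckerDouble) := by
  refine nonempty_iso_kroneckerDouble_lineGraph
    (s := fun e => if R e.fst e.snd then 0 else 1) (fun e => ?_) fun e f => ?_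
  · have := (hR.adj_iff _ _).1 e.adj
    have := hR.asymm e.fst e.snd
    simp only [Dart.symm, Prod.fst_swap, Prod.snd_swap]
    grind
  · have he := (hR.adj_iff _ _).1 e.adj
    have hf := (hR.adj_iff _ _).1 f.adj
    have hout := hR.out_unique
    have hin := hR.in_unique
    rw [coincidenceGraph_adj, ne_eq, ne_eq, dart_edge_eq_iff, exists_mem_edge_iff]
    simp only [dart_eq_iff, Dart.symm, Prod.fst_swap, Prod.snd_swap]
    grind

theorem isCoherentOrientation_pathGraph (n : ℕ) :
    IsCoherentOrientation (pathGraph n) fun i j => i.val + 1 = j.val where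
  adj_iff _ _ := pathGraph_adj
  asymm _ _ := by omega
  out_unique _ _ _ := by omega
  in_unique _ _ _ := by omega

theorem fin_one_add_one_ne_zero (n : ℕ) : (1 : Fin (n + 3)) + 1 ≠ 0 := by
  simp [Fin.ext_iff, Fin.val_add, Nat.mod_eq_of_lt]

theorem isCoherentOrientation_cycleGraph (n : ℕ) :
    IsCoherentOrientation (cycleGraph (n + 3)) fun i j => j - i = 1 where
  adj_iff _ _ := by rw [cycleGraph_adj, or_comm]
  asymm i j h h' := fin_one_add_one_ne_zero n <| calc
    (1 : Fin (n + 3)) + 1 = (j - i) + (i - j) := by rw [h, h']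
    _ = 0 := by abel
  out_unique _ _ _ h h' := sub_left_injective (h.trans h'.symm)
  in_unique _ _ _ h h' := sub_right_injective (h.trans h'.symm)

theorem nonempty_coincidenceGraph_iso_of_isPathGraph (h : X.IsPathGraph) :
    Nonempty (coincidenceGraph X ≃g X.lineGraph.kroneckerDouble) := by
  obtain ⟨n, -, ⟨φ⟩⟩ := h
  exact ((isCoherentOrientation_pathGraph n).comap_iso φ).nonempty_coincidenceGraph_iso

theorem nonempty_coincidenceGraph_iso_of_isCycleGraph (h : X.IsCycleGraph) :
    Nonempty (coincidenceGraph X ≃g X.lineGraph.kroneckerDouble) := by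
  obtain ⟨n, hn, ⟨φ⟩⟩ := h
  obtain ⟨n, rfl⟩ := Nat.exists_eq_add_of_le' hn
  exact ((isCoherentOrientation_cycleGraph n).comap_iso φ).nonempty_coincidenceGraph_iso

/-! ### Odd cycles -/

theorem even_of_cycleGraph_colorable_two {n : ℕ} (hn : 2 ≤ n) (h : (cycleGraph n).Colorable 2) :
    Even n := by
  rw [← Nat.not_odd_iff_even]
  intro hodd
  have hle := h.chromaticNumber_le
  rw [chromaticNumber_cycleGraph_of_odd n hn hodd] at hle
  norm_cast at hle

theorem even_length_add_one_of_isPath {u v : V} (h : X.Adj u v) {q : X.Walk v u}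
    (hq : q.IsPath) (hX : ∀ (v : V) (c : X.Walk v v), c.IsCycle → Even c.length) :
    Even (q.length + 1) := by
  obtain h0 | h1 | h2 : q.length = 0 ∨ q.length = 1 ∨ 2 ≤ q.length := by omega
  · exact absurd (Walk.eq_of_length_eq_zero h0) h.ne'
  · rw [h1]; decide
  · refine hX u (Walk.cons h q) ?_
    rw [Walk.isCycle_iff_isPath_tail_and_le_length]
    exact ⟨by simpa using hq, by simpa using h2⟩

open Classical in
theorem even_length_add_length_bypass (hX : ∀ (v : V) (c : X.Walk v v), c.IsCycle → Even c.length)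
    {u v : V} (p : X.Walk u v) : Even (p.length + p.bypass.length) := by
  induction p with
  | nil => simp [Walk.bypass]
  | @cons u v w h p ih =>
    rw [Walk.bypass]
    split_ifs with hu
    · have hsplit := congrArg Walk.length (p.bypass.take_spec hu)
      have := even_length_add_one_of_isPath h (p.bypass_isPath.takeUntil hu) hX
      rw [Walk.length_append] at hsplit
      rw [Walk.length_cons]
      grind
    · simp only [Walk.length_cons]
      grind

theorem isBipartite_of_forall_isCycle_even
    (hX : ∀ (v : V) (c : X.Walk v v), c.IsCycle → Even c.length) : X.IsBipartite := by
  classical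
  refine two_colorable_iff_forall_loop_even.2 fun v p => ?_
  have hnil : p.bypass.length = 0 :=
    Walk.length_eq_zero_iff.2 (Walk.isPath_iff_nil.1 p.bypass_isPath)
  simpa only [hnil, add_zero] using even_length_add_length_bypass hX p

theorem cycleGraph_colorable_of_isContained {n k : ℕ} (hn : 2 < n) (h : cycleGraph n ⊑ X)
    (hX : X.symmEdgeGraph.Colorable k) : (cycleGraph n).Colorable k := by
  obtain ⟨f⟩ := h
  obtain ⟨n, rfl⟩ := Nat.exists_eq_add_of_le' hn
  have hne (i : Fin (n + 3)) : f i ≠ f (i + 1 + 1) :=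
    f.injective.ne (by simpa [add_assoc] using fin_one_add_one_ne_zero n)
  have hadj (i : Fin (n + 3)) : X.Adj (f i) (f (i + 1)) :=
    f.toHom.map_adj (cycleGraph_adj.2 (by simp))
  refine hX.of_hom (G := cycleGraph (n + 3)) ⟨fun i => ⟨(f i, f (i + 1)), hadj i⟩, ?_⟩
  intro i j hij
  obtain hij | hij := cycleGraph_adj.1 hij
  · obtain rfl := eq_add_of_sub_eq' hij
    exact Or.inr ⟨rfl, hne j⟩
  · obtain rfl := eq_add_of_sub_eq' hij
    exact Or.inl ⟨rfl, hne i⟩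

theorem isBipartite_of_symmEdgeGraph_isBipartite (h : X.symmEdgeGraph.IsBipartite) :
    X.IsBipartite := by
  refine isBipartite_of_forall_isCycle_even fun v c hc => ?_
  have hlen : 2 < c.length := hc.three_le_length
  refine even_of_cycleGraph_colorable_two hlen.le (cycleGraph_colorable_of_isContained hlen ?_ h)
  exact (cycleGraph_isContained_iff hlen).2 ⟨v, c, hc, rfl⟩

theorem nonempty_symmEdgeGraph_iso_kroneckerDouble_lineGraph_iff :
    Nonempty (X.symmEdgeGraph ≃g X.lineGraph.kroneckerDouble) ↔ X.IsBipartite :=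
  ⟨fun ⟨ψ⟩ => isBipartite_of_symmEdgeGraph_isBipartite
    ((kroneckerDouble_isBipartite _).of_hom ψ.toHom), nonempty_symmEdgeGraph_iso_of_isBipartite⟩

/-! ### Graphs of maximum degree two -/

theorem eq_or_eq_of_encard_le_two {α : Type*} {s : Set α} (hs : s.encard ≤ 2) {a b c : α}
    (ha : a ∈ s) (hb : b ∈ s) (hab : a ≠ b) (hc : c ∈ s) : c = a ∨ c = b := by
  have hpair : {a, b} = s := (Set.toFinite {a, b}).eq_of_subset_of_encard_le
    (Set.pair_subset ha hb) (by rwa [Set.encard_pair hab])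
  simpa [← hpair] using hc

theorem mem_of_forall_adj_mem (hX : X.Preconnected) {s : Set V} (hs : s.Nonempty)
    (hclosed : ∀ x ∈ s, ∀ y, X.Adj x y → y ∈ s) (v : V) : v ∈ s := by
  obtain ⟨u, hu⟩ := hs
  obtain ⟨p⟩ := hX u v
  by_contra hv
  obtain ⟨d, -, hfst, hsnd⟩ := p.exists_boundary_dart s hu hv
  exact hsnd (hclosed _ hfst _ d.adj)

section DegreeAtMostTwo

/-- By maximality the ends of a longest path have no neighbor off the path, and an inner vertex
already has two neighbors on the path. -/
theorem mem_support_of_adj_of_forall_isPath_length_le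
    (hdeg : ∀ v, (X.neighborSet v).encard ≤ 2) {u v : V} {p : X.Walk u v} (hp : p.IsPath)
    (hmax : ∀ (u' v' : V) (q : X.Walk u' v'), q.IsPath → q.length ≤ p.length) {x y : V}
    (hx : x ∈ p.support) (hxy : X.Adj x y) : y ∈ p.support := by
  by_contra hy
  obtain ⟨i, rfl, hi⟩ := Walk.mem_support_iff_exists_getVert.1 hx
  obtain rfl | rfl | ⟨hpos, hlt⟩ : i = 0 ∨ i = p.length ∨ 0 < i ∧ i < p.length := by omega
  · rw [Walk.getVert_zero] at hxy
    simpa using hmax _ _ (Walk.cons hxy.symm p) (hp.cons hy)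
  · rw [Walk.getVert_length] at hxy
    simpa using hmax _ _ (p.concat hxy) (hp.concat hy hxy)
  · obtain ⟨i, rfl⟩ := Nat.exists_eq_add_of_lt hpos
    simp only [zero_add] at *
    have hne : p.getVert i ≠ p.getVert (i + 1 + 1) := fun h => by
      have := hp.getVert_injOn (show i ≤ p.length by omega) (show i + 1 + 1 ≤ p.length by omega) h
      omega
    obtain rfl | rfl := eq_or_eq_of_encard_le_two (hdeg (p.getVert (i + 1)))
      (p.adj_getVert_succ (by omega)).symm (p.adj_getVert_succ hlt) hne hxy
    all_goals exact hy (p.getVert_mem_support _)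

theorem exists_equiv_pathGraph_le_comap [Finite V] (hX : X.Connected)
    (hdeg : ∀ v, (X.neighborSet v).encard ≤ 2) :
    ∃ (n : ℕ) (e : Fin (n + 1) ≃ V), pathGraph (n + 1) ≤ X.comap e := by
  classical
  have := hX.nonempty
  obtain ⟨u, v, p, hp, hmax⟩ := Walk.exists_isPath_forall_isPath_length_le_length X
  have hham : p.IsHamiltonian := hp.isHamiltonian_of_mem <|
    mem_of_forall_adj_mem (s := {w | w ∈ p.support}) hX.preconnected ⟨u, p.start_mem_support⟩
      fun x hx y hxy => mem_support_of_adj_of_forall_isPath_length_le hdeg hp hmax hx hxy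
  refine ⟨p.length, (finCongr p.length_support.symm).trans hham.getVertEquiv, fun i j hij => ?_⟩
  obtain hij | hij := pathGraph_adj.1 hij
  · have := p.adj_getVert_succ (i := i.val) (by omega)
    rwa [hij] at this
  · have := p.adj_getVert_succ (i := j.val) (by omega)
    rw [hij] at this
    exact this.symm

theorem le_of_forall_lt_adj {α : Type*} [LinearOrder α] {G H : SimpleGraph α}
    (h : ∀ i j, i < j → G.Adj i j → H.Adj i j) : G ≤ H := by
  intro i j hij
  obtain hlt | hlt := hij.ne.lt_or_gt
  · exact h i j hlt hij
  · exact (h j i hlt hij.symm).symm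

theorem eq_of_forall_lt_adj_iff {α : Type*} [LinearOrder α] {G H : SimpleGraph α}
    (h : ∀ i j, i < j → (G.Adj i j ↔ H.Adj i j)) : G = H :=
  le_antisymm (le_of_forall_lt_adj fun i j hij => (h i j hij).1)
    (le_of_forall_lt_adj fun i j hij => (h i j hij).2)

theorem cycleGraph_adj_of_lt {n : ℕ} {i j : Fin n} (hij : i < j) :
    (cycleGraph n).Adj i j ↔ i.val + 1 = j.val ∨ i.val = 0 ∧ j.val + 1 = n := by
  have h₁ : (j - i).val = j.val - i.val := Fin.coe_sub_iff_le.2 hij.le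
  have h₂ : (i - j).val = n + i.val - j.val := Fin.coe_sub_iff_lt.2 hij
  rw [cycleGraph_adj', h₁, h₂]
  omega

variable {n : ℕ} {G : SimpleGraph (Fin n)}

theorem val_succ_eq_or_of_adj_of_lt (hG : pathGraph n ≤ G)
    (hdeg : ∀ i, (G.neighborSet i).encard ≤ 2) {i j : Fin n} (hij : i < j) (h : G.Adj i j) :
    i.val + 1 = j.val ∨ i.val = 0 ∧ j.val + 1 = n := by
  have hadj (k l : Fin n) (hkl : k.val + 1 = l.val) : G.Adj k l := hG (pathGraph_adj.2 (Or.inl hkl))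
  by_contra! hne
  obtain hi | hj : 0 < i.val ∨ j.val + 1 < n := by omega
  · have := eq_or_eq_of_encard_le_two (hdeg i)
      (hadj ⟨i - 1, by omega⟩ i (Nat.sub_add_cancel hi)).symm (hadj i ⟨i + 1, by omega⟩ rfl)
      (by grind) h
    grind
  · have := eq_or_eq_of_encard_le_two (hdeg j)
      (hadj ⟨j - 1, by omega⟩ j (Nat.sub_add_cancel (by omega))).symm (hadj j ⟨j + 1, hj⟩ rfl)
      (by grind) h.symm
    grind

theorem eq_pathGraph_or_eq_cycleGraph (hG : pathGraph n ≤ G)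
    (hdeg : ∀ i, (G.neighborSet i).encard ≤ 2) :
    G = pathGraph n ∨ 3 ≤ n ∧ G = cycleGraph n := by
  by_cases hpath : ∀ i j : Fin n, i < j → G.Adj i j → i.val + 1 = j.val
  · exact Or.inl (le_antisymm
      (le_of_forall_lt_adj fun i j hij h => pathGraph_adj.2 (Or.inl (hpath i j hij h))) hG)
  · push Not at hpath
    obtain ⟨a, b, hab, hadj, hne⟩ := hpath
    have hends := (val_succ_eq_or_of_adj_of_lt hG hdeg hab hadj).resolve_left hne
    refine Or.inr ⟨by omega, le_antisymm ?_ ?_⟩ <;> refine le_of_forall_lt_adj fun i j hij h => ?_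
    · exact (cycleGraph_adj_of_lt hij).2 (val_succ_eq_or_of_adj_of_lt hG hdeg hij h)
    · obtain hij | ⟨hi, hj⟩ := (cycleGraph_adj_of_lt hij).1 h
      · exact hG (pathGraph_adj.2 (Or.inl hij))
      · obtain rfl : i = a := by omega
        obtain rfl : j = b := by omega
        exact hadj

theorem isPathGraph_or_isCycleGraph [Finite V] (hX : X.Connected)
    (hdeg : ∀ v, (X.neighborSet v).encard ≤ 2) : X.IsPathGraph ∨ X.IsCycleGraph := by
  obtain ⟨n, e, he⟩ := exists_equiv_pathGraph_le_comap hX hdeg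
  have hdeg' (i : Fin (n + 1)) : ((X.comap e).neighborSet i).encard ≤ 2 :=
    (Set.encard_preimage_of_bijective e.bijective _).trans_le (hdeg (e i))
  obtain h | ⟨hn, h⟩ := eq_pathGraph_or_eq_cycleGraph he hdeg'
  · exact Or.inl ⟨n + 1, by omega, h ▸ ⟨(Iso.comap e X).symm⟩⟩
  · exact Or.inr ⟨n + 1, hn, h ▸ ⟨(Iso.comap e X).symm⟩⟩

end DegreeAtMostTwo

/-! ### Cliques and claws -/

theorem encard_neighborSet_lt_of_cliqueFree {n : ℕ} (h : (coincidenceGraph X).CliqueFree n)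
    (v : V) : (X.neighborSet v).encard < n := by
  by_contra! hn
  obtain ⟨t, htv, ht⟩ := Set.exists_subset_encard_eq hn
  have := (Set.finite_of_encard_eq_coe ht).fintype
  have hcard : Fintype.card t = n := by
    rw [← Nat.card_eq_fintype_card, Nat.card_coe_set_eq, Set.ncard, ht, ENat.toNat_natCast]
  let star (w : t) : X.Dart := X.dartOfNeighborSet v ⟨w, htv w.2⟩
  have hinj : Function.Injective star := fun w w' hw =>
    Subtype.ext (Subtype.mk.inj (X.dartOfNeighborSet_injective v hw))
  have hstar : completeGraph t ⊑ coincidenceGraph X :=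
    ⟨⟨star, fun hww' => ⟨hinj.ne hww', Or.inl rfl⟩⟩, hinj⟩
  rw [← hcard, cliqueFree_iff_top_free] at h
  exact h hstar

theorem encard_neighborSet_le_two_of_cliqueFree (h : (coincidenceGraph X).CliqueFree 3) (v : V) :
    (X.neighborSet v).encard ≤ 2 :=
  Order.le_of_lt_add_one (encard_neighborSet_lt_of_cliqueFree h v)

theorem directed_triangle_of_symmEdgeGraph_adj {e f g : X.Dart} (hef : X.symmEdgeGraph.Adj e f)
    (heg : X.symmEdgeGraph.Adj e g) (hfg : X.symmEdgeGraph.Adj f g) :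
    (e.snd = f.fst ∧ f.snd = g.fst ∧ g.snd = e.fst) ∨
      (f.snd = e.fst ∧ g.snd = f.fst ∧ e.snd = g.fst) := by
  have he := e.fst_ne_snd
  have hf := f.fst_ne_snd
  have hg := g.fst_ne_snd
  rw [symmEdgeGraph_adj] at hef heg hfg
  grind

/-- Two adjacent darts span at most one directed triangle. -/
theorem symmEdgeGraph_cliqueFree_four (X : SimpleGraph V) : X.symmEdgeGraph.CliqueFree 4 := by
  by_contra h
  obtain ⟨f⟩ := (not_cliqueFree_iff_top_isContained 4).1 h
  have hadj (i j : Fin 4) (hij : i ≠ j) : X.symmEdgeGraph.Adj (f i) (f j) := f.toHom.map_adj hij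
  have htri (i : Fin 4) (h₀ : 0 ≠ i) (h₁ : 1 ≠ i) :=
    directed_triangle_of_symmEdgeGraph_adj (hadj 0 1 (by decide)) (hadj 0 i h₀) (hadj 1 i h₁)
  refine (hadj 2 3 (by decide)).ne (dart_eq_iff.2 ?_)
  have h₂ := htri 2 (by decide) (by decide)
  have h₃ := htri 3 (by decide) (by decide)
  have h₀₁ := hadj 0 1 (by decide)
  rw [symmEdgeGraph_adj] at h₀₁
  grind

theorem symmEdgeGraph_cliqueFree_three (hX : X.CliqueFree 3) : X.symmEdgeGraph.CliqueFree 3 := by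
  classical
  intro s hs
  obtain ⟨e, f, g, hef, heg, hfg, -⟩ := is3Clique_iff.1 hs
  refine hX {e.fst, f.fst, g.fst} (is3Clique_triple_iff.2 ?_)
  obtain ⟨h₁, h₂, h₃⟩ | ⟨h₁, h₂, h₃⟩ := directed_triangle_of_symmEdgeGraph_adj hef heg hfg
  · exact ⟨h₁ ▸ e.adj, h₃ ▸ g.adj.symm, h₂ ▸ f.adj⟩
  · exact ⟨h₁ ▸ f.adj.symm, h₃ ▸ e.adj, h₂ ▸ g.adj.symm⟩

/-- No three neighbors of a vertex are pairwise distinct and non-adjacent, that is, `G` has no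
induced subgraph `K₁,₃`. -/
def IsClawFree (G : SimpleGraph V) : Prop :=
  ∀ v a b c, G.Adj v a → G.Adj v b → G.Adj v c → a ≠ b → a ≠ c → b ≠ c →
    G.Adj a b ∨ G.Adj a c ∨ G.Adj b c

theorem IsClawFree.of_isIndContained (hY : IsClawFree Y) (h : X ⊴ Y) : IsClawFree X := by
  obtain ⟨φ⟩ := h
  intro v a b c ha hb hc hab hac hbc
  simpa only [φ.map_adj_iff] using hY (φ v) (φ a) (φ b) (φ c) (φ.map_adj_iff.2 ha)
    (φ.map_adj_iff.2 hb) (φ.map_adj_iff.2 hc) (φ.injective.ne hab) (φ.injective.ne hac)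
    (φ.injective.ne hbc)

/-- Of three edges meeting a given edge, two meet it in the same end. -/
theorem isClawFree_lineGraph (X : SimpleGraph V) : IsClawFree X.lineGraph := by
  intro e a b c ha hb hc hab hac hbc
  simp only [lineGraph_adj_iff_exists] at *
  obtain ⟨-, x, hxe, hxa⟩ := ha
  obtain ⟨-, y, hye, hyb⟩ := hb
  obtain ⟨-, z, hze, hzc⟩ := hc
  obtain rfl | rfl | rfl : x = y ∨ x = z ∨ y = z := by
    obtain ⟨⟨p, q⟩, he⟩ := e
    simp only [Sym2.mem_iff] at hxe hye hze
    grind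
  · exact Or.inl ⟨hab, x, hxa, hyb⟩
  · exact Or.inr (Or.inl ⟨hac, x, hxa, hzc⟩)
  · exact Or.inr (Or.inr ⟨hbc, y, hyb, hzc⟩)

/-- The darts `(v, b)`, `(v, c)` and `(y, a)` are neighbors of `(a, v)` in the symmetric edge graph;
they form a claw unless `y` is `b` or `c`. -/
theorem eq_or_eq_of_isClawFree_symmEdgeGraph (hX : IsClawFree X.symmEdgeGraph) {v a b c y : V}
    (ha : X.Adj v a) (hb : X.Adj v b) (hc : X.Adj v c) (hab : a ≠ b) (hac : a ≠ c) (hbc : b ≠ c)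
    (hy : X.Adj a y) (hyv : y ≠ v) : y = b ∨ y = c := by
  have hclaw := hX ⟨(a, v), ha.symm⟩ ⟨(v, b), hb⟩ ⟨(v, c), hc⟩ ⟨(y, a), hy.symm⟩
    (Or.inl ⟨rfl, hab⟩) (Or.inl ⟨rfl, hac⟩) (Or.inr ⟨rfl, hyv⟩)
  have hva := ha.ne
  have hvb := hb.ne
  have hvc := hc.ne
  simp only [symmEdgeGraph_adj, ne_eq, dart_eq_iff] at hclaw
  grind

theorem isUniversal_of_isClawFree_symmEdgeGraph (hX : X.Preconnected)
    (hclaw : IsClawFree X.symmEdgeGraph) {v : V} (hv : 2 < (X.neighborSet v).encard) :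
    X.IsUniversal v := by
  suffices hall : ∀ u, u ∈ insert v (X.neighborSet v) from
    fun u hu => (hall u).resolve_left hu.symm
  refine mem_of_forall_adj_mem hX ⟨v, Set.mem_insert _ _⟩ ?_
  rintro x (rfl | hx) y hxy
  · exact Or.inr hxy
  by_cases hyv : y = v
  · exact Or.inl hyv
  have hrest : 1 < (X.neighborSet v \ {x}).encard := by
    rw [← Set.encard_sdiff_singleton_add_one hx, ← one_add_one_eq_two] at hv
    exact lt_of_add_lt_add_right hv
  obtain ⟨b, c, ⟨hb, hbx⟩, ⟨hc, hcx⟩, hbc⟩ := Set.one_lt_encard_iff.1 hrest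
  obtain rfl | rfl := eq_or_eq_of_isClawFree_symmEdgeGraph hclaw hx hb hc (Ne.symm hbx)
    (Ne.symm hcx) hbc hxy hyv
  · exact Or.inr hb
  · exact Or.inr hc

/-! ### Graphs on four vertices -/

theorem completeFourMinusEdge_adj {i j : Fin 4} :
    completeFourMinusEdge.Adj i j ↔ i ≠ j ∧ ¬ (i = 0 ∧ j = 1) ∧ ¬ (i = 1 ∧ j = 0) := by
  simp [completeFourMinusEdge, completeGraph]

theorem triangleWithPendant_adj {i j : Fin 4} :
    triangleWithPendant.Adj i j ↔ i ≠ j ∧ (i = 3 → j = 2) ∧ (j = 3 → i = 2) := by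
  simp only [triangleWithPendant, fromEdgeSet_adj, Set.mem_insert_iff, Set.mem_singleton_iff,
    Sym2.eq_iff]
  revert i j
  decide

theorem exists_adj_adj_of_isUniversal {v : V} (hv : X.IsUniversal v) (htri : ¬ X.CliqueFree 3) :
    ∃ a b, X.Adj v a ∧ X.Adj v b ∧ X.Adj a b := by
  classical
  simp only [CliqueFree, not_forall, not_not] at htri
  obtain ⟨s, hs⟩ := htri
  obtain ⟨x, y, z, hxy, hxz, hyz, -⟩ := is3Clique_iff.1 hs
  by_cases hvx : v = x
  · exact ⟨y, z, hvx ▸ hxy, hvx ▸ hxz, hyz⟩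
  by_cases hvy : v = y
  · exact ⟨x, z, hvy ▸ hxy.symm, hvy ▸ hyz, hxz⟩
  exact ⟨x, y, hv hvx, hv hvy, hxy⟩

theorem exists_diff_pair_eq_singleton {α : Type*} {s : Set α} (hs : s.encard = 3) {a b : α}
    (ha : a ∈ s) (hb : b ∈ s) (hab : a ≠ b) : ∃ c, s \ {a, b} = {c} := by
  have hsplit := Set.encard_sdiff_add_encard_of_subset (Set.pair_subset ha hb)
  rw [hs, Set.encard_pair hab] at hsplit
  exact Set.encard_eq_one.1 (WithTop.add_right_cancel (ENat.natCast_ne_top 2) hsplit)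

theorem bijective_vecCons_four {a b c d : V} (hab : a ≠ b) (hac : a ≠ c) (had : a ≠ d)
    (hbc : b ≠ c) (hbd : b ≠ d) (hcd : c ≠ d) (hall : ∀ x, x = a ∨ x = b ∨ x = c ∨ x = d) :
    Function.Bijective ![a, b, c, d] := by
  constructor
  · intro i j h
    fin_cases i <;> fin_cases j <;> simp_all
  · intro x
    obtain rfl | rfl | rfl | rfl := hall x
    exacts [⟨0, rfl⟩, ⟨1, rfl⟩, ⟨2, rfl⟩, ⟨3, rfl⟩]

theorem triangleWithPendant_le {Y : SimpleGraph (Fin 4)} (h₀₁ : Y.Adj 0 1) (h₀₂ : Y.Adj 0 2)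
    (h₁₂ : Y.Adj 1 2) (h₂₃ : Y.Adj 2 3) : triangleWithPendant ≤ Y := by
  rw [triangleWithPendant, fromEdgeSet_le]
  rintro z ⟨rfl | rfl | rfl | rfl, -⟩ <;> assumption

theorem exists_equiv_triangleWithPendant_le_comap {v : V} (hv : X.IsUniversal v)
    (hcard : (X.neighborSet v).encard = 3) (htri : ¬ X.CliqueFree 3) :
    ∃ e : Fin 4 ≃ V, triangleWithPendant ≤ X.comap e := by
  obtain ⟨a, b, ha, hb, hab⟩ := exists_adj_adj_of_isUniversal hv htri
  obtain ⟨c, hc⟩ := exists_diff_pair_eq_singleton hcard ha hb hab.ne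
  simp only [Set.ext_iff, Set.mem_sdiff, mem_neighborSet, Set.mem_insert_iff,
    Set.mem_singleton_iff, not_or] at hc
  obtain ⟨hvc, hca, hcb⟩ := (hc c).2 rfl
  have hall (x : V) : x = a ∨ x = b ∨ x = v ∨ x = c := by
    have := @hv x
    have := hc x
    grind
  exact ⟨Equiv.ofBijective _ (bijective_vecCons_four hab.ne ha.ne' (Ne.symm hca) hb.ne'
    (Ne.symm hcb) hvc.ne hall), triangleWithPendant_le hab ha.symm hb.symm hvc⟩

theorem nonempty_iso_of_triangleWithPendant_le {Y : SimpleGraph (Fin 4)}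
    (hY : triangleWithPendant ≤ Y) :
    Nonempty (Y ≃g completeGraph (Fin 4)) ∨ Nonempty (Y ≃g completeFourMinusEdge) ∨
      Nonempty (Y ≃g triangleWithPendant) := by
  have h₀₁ : Y.Adj 0 1 := hY (triangleWithPendant_adj.2 (by decide))
  have h₁₂ : Y.Adj 1 2 := hY (triangleWithPendant_adj.2 (by decide))
  have h₀₂ : Y.Adj 0 2 := hY (triangleWithPendant_adj.2 (by decide))
  have h₂₃ : Y.Adj 2 3 := hY (triangleWithPendant_adj.2 (by decide))
  have hiso {H : SimpleGraph (Fin 4)} (σ : Equiv.Perm (Fin 4))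
      (h : ∀ i j, i < j → (Y.Adj (σ i) (σ j) ↔ H.Adj i j)) : Nonempty (Y ≃g H) := by
    rw [← eq_of_forall_lt_adj_iff (G := Y.comap σ) h]
    exact ⟨(Iso.comap σ Y).symm⟩
  by_cases h₀₃ : Y.Adj 0 3 <;> by_cases h₁₃ : Y.Adj 1 3
  · refine Or.inl (hiso 1 ?_)
    simp [Fin.forall_fin_succ, completeGraph, *]
  · refine Or.inr (Or.inl (hiso (Equiv.swap 0 3) ?_))
    simp [Fin.forall_fin_succ, completeFourMinusEdge_adj, Equiv.swap_apply_def, Y.adj_comm 3,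
      h₀₁.symm, h₀₂.symm, *]
  · refine Or.inr (Or.inl (hiso (Equiv.swap 1 3) ?_))
    simp [Fin.forall_fin_succ, completeFourMinusEdge_adj, Equiv.swap_apply_def, Y.adj_comm 3,
      h₁₂.symm, *]
  · refine Or.inr (Or.inr (hiso 1 ?_))
    simp [Fin.forall_fin_succ, triangleWithPendant_adj, *]

/-- The dart of `K₄` from `k` to `l`, where `(i, j, k, l)` is an even permutation of `(0, 1, 2, 3)`;
the value for `i = j` is irrelevant. -/
def oppositeDart : Fin 4 → Fin 4 → Fin 4 × Fin 4 :=
  ![![(0, 0), (2, 3), (3, 1), (1, 2)],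
    ![(3, 2), (0, 0), (0, 3), (2, 0)],
    ![(1, 3), (3, 0), (0, 0), (0, 1)],
    ![(2, 1), (0, 2), (1, 0), (0, 0)]]

theorem oppositeDart_injective : ∀ i j k l : Fin 4, i ≠ j → k ≠ l →
    oppositeDart i j = oppositeDart k l → i = k ∧ j = l := by
  decide

theorem oppositeDart_coincide_iff : ∀ i j k l : Fin 4, i ≠ j → k ≠ l →
    (oppositeDart i j ≠ oppositeDart k l ∧ ((oppositeDart i j).1 = (oppositeDart k l).1 ∨
      (oppositeDart i j).2 = (oppositeDart k l).2) ↔ j = k ∧ i ≠ l ∨ l = i ∧ k ≠ j) := by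
  decide

theorem nonempty_symmEdgeGraph_iso_coincidenceGraph_of_oppositeDart {Y : SimpleGraph (Fin 4)}
    (φ : X ≃g Y) (σ : Equiv.Perm (Fin 4))
    (hσ : ∀ i j, Y.Adj i j → Y.Adj (σ (oppositeDart i j).1) (σ (oppositeDart i j).2)) :
    Nonempty (X.symmEdgeGraph ≃g coincidenceGraph X) := by
  have : Finite X.Dart := Finite.of_injective
    (fun e => (φ e.fst, φ e.snd)) fun e f h => by simpa [dart_eq_iff] using h
  have hne (e : X.Dart) : φ e.fst ≠ φ e.snd := φ.injective.ne e.fst_ne_snd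
  let τ (i : Fin 4) : V := φ.symm (σ i)
  have hτ : Function.Injective τ := φ.symm.injective.comp σ.injective
  let opp (e : X.Dart) : Fin 4 × Fin 4 := oppositeDart (φ e.fst) (φ e.snd)
  let F (e : X.Dart) : X.Dart :=
    ⟨(τ (opp e).1, τ (opp e).2), φ.symm.map_adj_iff.2 (hσ _ _ (φ.map_adj_iff.2 e.adj))⟩
  have hF_eq {e f : X.Dart} : F e = F f ↔ opp e = opp f := by
    simp only [F, dart_eq_iff, hτ.eq_iff, Prod.ext_iff]
  have hF : Function.Injective F := fun e f h => by
    obtain ⟨hfst, hsnd⟩ := oppositeDart_injective _ _ _ _ (hne e) (hne f) (hF_eq.1 h)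
    exact dart_eq_iff.2 ⟨φ.injective hfst, φ.injective hsnd⟩
  refine ⟨Equiv.ofBijective F (Finite.injective_iff_bijective.1 hF), fun {e f} => ?_⟩
  have := oppositeDart_coincide_iff _ _ _ _ (hne e) (hne f)
  rw [Equiv.ofBijective_apply, Equiv.ofBijective_apply, coincidenceGraph_adj, ne_eq, hF_eq,
    symmEdgeGraph_adj]
  simpa only [F, hτ.eq_iff, φ.injective.eq_iff, ne_eq] using this

theorem nonempty_symmEdgeGraph_iso_coincidenceGraph_of_four_vertices
    (h : Nonempty (X ≃g completeGraph (Fin 4)) ∨ Nonempty (X ≃g completeFourMinusEdge) ∨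
      Nonempty (X ≃g triangleWithPendant)) :
    Nonempty (X.symmEdgeGraph ≃g coincidenceGraph X) := by
  obtain ⟨⟨φ⟩⟩ | ⟨⟨φ⟩⟩ | ⟨⟨φ⟩⟩ := h
  · refine nonempty_symmEdgeGraph_iso_coincidenceGraph_of_oppositeDart φ 1 ?_
    simp only [completeGraph, top_adj]
    decide
  · refine nonempty_symmEdgeGraph_iso_coincidenceGraph_of_oppositeDart φ
      (Equiv.swap 0 2 * Equiv.swap 1 3) ?_
    simp only [completeFourMinusEdge_adj]
    decide
  · refine nonempty_symmEdgeGraph_iso_coincidenceGraph_of_oppositeDart φ (Equiv.swap 2 3) ?_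
    simp only [triangleWithPendant_adj]
    decide

/-! ### The classification -/

theorem isBipartite_of_isPathGraph (h : X.IsPathGraph) : X.IsBipartite := by
  obtain ⟨n, -, ⟨φ⟩⟩ := h
  exact (pathGraph.bicoloring n).colorable.of_hom φ.toHom

theorem isBipartite_of_isEvenCycleGraph (h : X.IsEvenCycleGraph) : X.IsBipartite := by
  obtain ⟨n, -, hn, ⟨φ⟩⟩ := h
  exact (cycleGraph.bicoloring_of_even n hn).colorable.of_hom φ.toHom

theorem isCycleGraph_of_isEvenCycleGraph (h : X.IsEvenCycleGraph) : X.IsCycleGraph := by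
  obtain ⟨n, hn, -, hφ⟩ := h
  exact ⟨n, hn, hφ⟩

theorem isEvenCycleGraph_of_isBipartite (h : X.IsCycleGraph) (hX : X.IsBipartite) :
    X.IsEvenCycleGraph := by
  obtain ⟨n, hn, ⟨φ⟩⟩ := h
  exact ⟨n, hn, even_of_cycleGraph_colorable_two (by omega) (hX.of_hom φ.symm.toHom), ⟨φ⟩⟩

theorem nonempty_coincidenceGraph_iso_kroneckerDouble_lineGraph
    (h : X.IsCycleGraph ∨ X.IsPathGraph) :
    Nonempty (coincidenceGraph X ≃g X.lineGraph.kroneckerDouble) :=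
  h.elim nonempty_coincidenceGraph_iso_of_isCycleGraph nonempty_coincidenceGraph_iso_of_isPathGraph

theorem nonempty_lineGraph_kroneckerDouble_iso_kroneckerDouble_lineGraph_iff [Finite V]
    (hX : X.Connected) :
    Nonempty (X.kroneckerDouble.lineGraph ≃g X.lineGraph.kroneckerDouble) ↔
      X.IsCycleGraph ∨ X.IsPathGraph := by
  refine ⟨fun ⟨ψ⟩ => ?_, fun h => ?_⟩
  · have hcolor : (coincidenceGraph X).Colorable 2 :=
      (kroneckerDouble_isBipartite _).of_hom (ψ.comp (coincidenceGraphIso X)).toHom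
    exact (isPathGraph_or_isCycleGraph hX fun v =>
      encard_neighborSet_le_two_of_cliqueFree (hcolor.cliqueFree (by norm_num)) v).symm
  · obtain ⟨φ⟩ := nonempty_coincidenceGraph_iso_kroneckerDouble_lineGraph h
    exact ⟨φ.comp (coincidenceGraphIso X).symm⟩

theorem isPathGraph_or_isEvenCycleGraph_of_encard_neighborSet_le_two [Finite V] (hX : X.Connected)
    (φ : X.symmEdgeGraph ≃g coincidenceGraph X) (hdeg : ∀ v, (X.neighborSet v).encard ≤ 2) :
    X.IsPathGraph ∨ X.IsEvenCycleGraph := by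
  refine (isPathGraph_or_isCycleGraph hX hdeg).imp_right fun h => ?_
  obtain ⟨ψ⟩ := nonempty_coincidenceGraph_iso_of_isCycleGraph h
  exact isEvenCycleGraph_of_isBipartite h
    (nonempty_symmEdgeGraph_iso_kroneckerDouble_lineGraph_iff.1 ⟨ψ.comp φ⟩)

theorem nonempty_iso_of_two_lt_encard_neighborSet (hX : X.Preconnected)
    (φ : X.symmEdgeGraph ≃g coincidenceGraph X) {v : V} (hv : 2 < (X.neighborSet v).encard) :
    Nonempty (X ≃g completeGraph (Fin 4)) ∨ Nonempty (X ≃g completeFourMinusEdge) ∨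
      Nonempty (X ≃g triangleWithPendant) := by
  have hclaw : IsClawFree X.symmEdgeGraph :=
    (isClawFree_lineGraph _).of_isIndContained ⟨(φ.trans (coincidenceGraphIso X)).toRelEmbedding⟩
  have hfour : (coincidenceGraph X).CliqueFree 4 :=
    (symmEdgeGraph_cliqueFree_four X).comap φ.isContained'
  have hcard : (X.neighborSet v).encard = 3 :=
    le_antisymm (Order.le_of_lt_add_one (encard_neighborSet_lt_of_cliqueFree hfour v))
      (Order.add_one_le_of_lt hv)
  have htri : ¬ X.CliqueFree 3 := fun h => hv.not_ge <| encard_neighborSet_le_two_of_cliqueFree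
    ((symmEdgeGraph_cliqueFree_three h).comap φ.isContained') v
  obtain ⟨e, he⟩ := exists_equiv_triangleWithPendant_le_comap
    (isUniversal_of_isClawFree_symmEdgeGraph hX hclaw hv) hcard htri
  have ψ : X ≃g X.comap e := (Iso.comap e X).symm
  exact (nonempty_iso_of_triangleWithPendant_le he).imp (Nonempty.map ψ.trans)
    (Or.imp (Nonempty.map ψ.trans) (Nonempty.map ψ.trans))

theorem nonempty_symmEdgeGraph_iso_lineGraph_kroneckerDouble_iff [Finite V] (hX : X.Connected) :
    Nonempty (X.symmEdgeGraph ≃g X.kroneckerDouble.lineGraph) ↔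
      X.IsPathGraph ∨ X.IsEvenCycleGraph ∨
        Nonempty (X ≃g completeGraph (Fin 4)) ∨ Nonempty (X ≃g completeFourMinusEdge) ∨
        Nonempty (X ≃g triangleWithPendant) := by
  suffices h : Nonempty (X.symmEdgeGraph ≃g coincidenceGraph X) ↔ _ from
    (Nonempty.congr (fun φ => φ.trans (coincidenceGraphIso X))
      fun φ => φ.trans (coincidenceGraphIso X).symm).symm.trans h
  rw [← or_assoc]
  refine ⟨fun ⟨φ⟩ => ?_, ?_⟩
  · by_cases! hdeg : ∀ v, (X.neighborSet v).encard ≤ 2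
    · exact Or.inl (isPathGraph_or_isEvenCycleGraph_of_encard_neighborSet_le_two hX φ hdeg)
    · obtain ⟨v, hv⟩ := hdeg
      exact Or.inr (nonempty_iso_of_two_lt_encard_neighborSet hX.preconnected φ hv)
  · rintro (h | h)
    · have hbip : X.IsBipartite :=
        h.elim isBipartite_of_isPathGraph isBipartite_of_isEvenCycleGraph
      obtain ⟨φ⟩ := nonempty_symmEdgeGraph_iso_of_isBipartite hbip
      obtain ⟨ψ⟩ := nonempty_coincidenceGraph_iso_kroneckerDouble_lineGraph
        (h.symm.imp_left isCycleGraph_of_isEvenCycleGraph)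
      exact ⟨φ.trans ψ.symm⟩
    · exact nonempty_symmEdgeGraph_iso_coincidenceGraph_of_four_vertices h

end LineGraphCover

theorem mainTheorem1 {V : Type*} [Finite V] (X : SimpleGraph V) (hX : X.Connected) :
    (Nonempty (X.symmEdgeGraph ≃g X.lineGraph.kroneckerDouble) ↔ X.IsBipartite) ∧
    (Nonempty (X.symmEdgeGraph ≃g X.kroneckerDouble.lineGraph) ↔
      X.IsPathGraph ∨ X.IsEvenCycleGraph ∨
        Nonempty (X ≃g SimpleGraph.completeGraph (Fin 4)) ∨
        Nonempty (X ≃g SimpleGraph.completeFourMinusEdge) ∨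
        Nonempty (X ≃g SimpleGraph.triangleWithPendant)) ∧
    (Nonempty (X.kroneckerDouble.lineGraph ≃g X.lineGraph.kroneckerDouble) ↔
      X.IsCycleGraph ∨ X.IsPathGraph) :=
  ⟨LineGraphCover.nonempty_symmEdgeGraph_iso_kroneckerDouble_lineGraph_iff,
    LineGraphCover.nonempty_symmEdgeGraph_iso_lineGraph_kroneckerDouble_iff hX,
    LineGraphCover.nonempty_lineGraph_kroneckerDouble_iso_kroneckerDouble_lineGraph_iff hX⟩
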